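/- Let $\mathbb T=\{z\in\mathbb C:|z|=1\}$ and $\mathbb T_+=\{z\in\mathbb T:\operatorname{Re} z\ge 0\}$. For an abelian group $G$ with a group topology $\tau$, let $(G,\tau)^\wedge$ be the group of all $\tau$-continuous homomorphisms $G\to\mathbb T$. A set $M\subseteq G$ is quasi-convex in $(G,\tau)$ if for every $x\in G\setminus M$ there is $\chi\in(G,\tau)^\wedge$ with $\chi(M)\subseteq\mathbb T_+$ and $\chi(x)\notin\mathbb T_+$; and $\tau$ is locally quasi-convex if it has a neighbourhood basis at $0$ consisting of quasi-convex sets. A Hausdorff locally quasi-convex group topology $\tau$ on $G$ is called Mackey if it is finer than or equal to every Hausdorff locally quasi-convex group topology $\nu$ on $G$ with $(G,\nu)^\wedge=(G,\tau)^\wedge$. Theorem A. For an abelian group $G$, the following are equivalent: (i) every metrizable locally quasi-convex group topology on $G$ is Mackey (i.e. $G$ satisfies the Varopoulos paradigm); (ii) $G$ is bounded, i.e. there is a positive integer $m$ with $mG=\{0\}$. -/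

import Mathlib

namespace VaropoulosParadigm

/-- The dual group `(G, τ)^∧`: all `τ`-continuous homomorphisms from the additive group `G` to the
circle group `𝕋`, as a subset of the set `Hom(G, 𝕋) = AddChar G Circle` of all characters. -/
def dual {G : Type*} [AddCommGroup G] (τ : TopologicalSpace G) : Set (AddChar G Circle) :=
  {χ | @Continuous G Circle τ inferInstance (fun x => χ x)}

/-- The right half `𝕋₊ = {z ∈ 𝕋 : Re z ≥ 0}` of the circle group. -/
def circlePos : Set Circle := {z | 0 ≤ (z : ℂ).re}

/-- `M` is quasi-convex in `(G, τ)`: every point outside `M` is separated from `M` by a continuous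
character which maps `M` into `𝕋₊` and the point outside `𝕋₊`. -/
def IsQuasiConvex {G : Type*} [AddCommGroup G] (τ : TopologicalSpace G) (M : Set G) : Prop :=
  ∀ x, x ∉ M → ∃ χ ∈ dual τ, (∀ y ∈ M, χ y ∈ circlePos) ∧ χ x ∉ circlePos

/-- `τ` has a neighbourhood basis at `0` consisting of quasi-convex sets. -/
def IsLocallyQuasiConvex {G : Type*} [AddCommGroup G] (τ : TopologicalSpace G) : Prop :=
  ∀ U ∈ @nhds G τ 0, ∃ M ∈ @nhds G τ 0, IsQuasiConvex τ M ∧ M ⊆ U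

/-- `τ` is a Hausdorff locally quasi-convex group topology on `G`. -/
structure IsLqcGroupTopology {G : Type*} [AddCommGroup G] (τ : TopologicalSpace G) : Prop where
  isTopologicalAddGroup : @IsTopologicalAddGroup G τ _
  t2Space : @T2Space G τ
  isLocallyQuasiConvex : IsLocallyQuasiConvex τ

/-- The family `𝒞(G, τ)` of all Hausdorff locally quasi-convex group topologies on `G` which are
compatible with `τ`, i.e. have the same continuous characters as `τ`. -/
def compatibleTopologies {G : Type*} [AddCommGroup G] (τ : TopologicalSpace G) :
    Set (TopologicalSpace G) :=
  {ν | IsLqcGroupTopology ν ∧ dual ν = dual τ}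

/-- `μ` is the Mackey topology for `(G, τ)`: it is the finest member of `𝒞(G, τ)`. In Mathlib's
order on topologies, `μ ≤ ν` says that `μ` is finer than `ν`. -/
def IsMackeyTopologyFor {G : Type*} [AddCommGroup G] (τ μ : TopologicalSpace G) : Prop :=
  μ ∈ compatibleTopologies τ ∧ ∀ ν ∈ compatibleTopologies τ, μ ≤ ν

/-- The topology `τ` is Mackey, i.e. it is the Mackey topology for `(G, τ)`. -/
def IsMackey {G : Type*} [AddCommGroup G] (τ : TopologicalSpace G) : Prop :=
  IsMackeyTopologyFor τ τ

/-- `G` satisfies the Varopoulos paradigm: every metrizable locally quasi-convex group topology on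
`G` is Mackey. -/
def SatisfiesVaropoulosParadigm (G : Type*) [AddCommGroup G] : Prop :=
  ∀ τ : TopologicalSpace G, @IsTopologicalAddGroup G τ _ →
    @TopologicalSpace.MetrizableSpace G τ → IsLocallyQuasiConvex τ → IsMackey τ

/-- `G` is bounded: `m G = 0` for some positive integer `m`. -/
def IsBoundedGroup (G : Type*) [AddCommGroup G] : Prop :=
  ∃ m : ℕ, 0 < m ∧ ∀ x : G, m • x = 0

end VaropoulosParadigm

/-! Bounded groups. If `m G = 0` and `M` is a quasi-convex neighbourhood of `0` for `ν`, then a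
character mapping `M` into `𝕋₊` is trivial at every `x` whose first `m` multiples lie in `M`,
because `𝕋₊` contains no nontrivial subgroup. So `M` contains a `ν`-open subgroup `H`. The
characters killing `H` are `ν`-continuous, hence `τ`-continuous when the duals agree. If `H` were
not `τ`-open, a `τ`-null sequence would avoid it, and by Baire some character of `G ⧸ H` would be
nontrivial on infinitely many terms; its values are `m`-th roots of unity, so it cannot be
continuous.

Unbounded groups. On a countable unbounded subgroup `H` one builds characters `χ n → 1` pointwise
whose value sequences `(χ n x)` are uniformly dense among the finitely supported sequences in `𝕋`,
so that `H` behaves like a dense subgroup of `c₀(𝕋)`. The topology of pointwise convergence and that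
of uniform convergence of `(χ n)`, both made Hausdorff by auxiliary `ψ i`, are metrizable and
locally quasi-convex. They differ, yet a gliding hump (`exists_block`,
`pointwise_continuous_of_uniformlyContinuousOn`) shows that they have the same dual, so the coarser
one is not Mackey. The `χ n` come from Baire category in the compact dual of `H`, which makes them
independent, and from Kronecker's theorem, which turns independence into density. -/

namespace VaropoulosParadigm

/-! ### Metric estimates on the circle -/

/-- The distance from `z` to `1` in the circle group. -/
noncomputable def circleNorm (z : Circle) : ℝ := ‖(z : ℂ) - 1‖

lemma circleNorm_nonneg (z : Circle) : 0 ≤ circleNorm z := norm_nonneg _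

lemma circleNorm_one : circleNorm 1 = 0 := by simp [circleNorm]

lemma circleNorm_eq_zero {z : Circle} : circleNorm z = 0 ↔ z = 1 := by
  rw [circleNorm, norm_eq_zero, sub_eq_zero, Circle.coe_eq_one]

lemma circleNorm_le_two (z : Circle) : circleNorm z ≤ 2 := by
  have := norm_sub_le (z : ℂ) 1
  rw [Circle.norm_coe, norm_one] at this
  unfold circleNorm; linarith

lemma circleNorm_mul_le (z w : Circle) : circleNorm (z * w) ≤ circleNorm z + circleNorm w := by
  have h : ((z * w : Circle) : ℂ) - 1 = z * (w - 1) + (z - 1) := by push_cast; ring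
  unfold circleNorm
  rw [h]
  refine (norm_add_le _ _).trans ?_
  rw [norm_mul, Circle.norm_coe, one_mul, add_comm]

lemma circleNorm_inv (z : Circle) : circleNorm z⁻¹ = circleNorm z := by
  have h : ((z⁻¹ : Circle) : ℂ) - 1 = -(z⁻¹ : Circle) * (z - 1) := by
    push_cast
    have := z.coe_ne_zero
    field_simp
    ring
  unfold circleNorm
  rw [h, norm_mul, norm_neg, Circle.norm_coe, one_mul]

lemma circleNorm_div_le (z w : Circle) : circleNorm (z / w) ≤ circleNorm z + circleNorm w := by
  rw [div_eq_mul_inv, ← circleNorm_inv w]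
  exact circleNorm_mul_le _ _

lemma circleNorm_pow_le (z : Circle) (n : ℕ) : circleNorm (z ^ n) ≤ n * circleNorm z := by
  induction n with
  | zero => simp [circleNorm_one]
  | succ n ih =>
    rw [pow_succ]
    refine (circleNorm_mul_le _ _).trans ?_
    push_cast
    linarith

lemma circleNorm_div_comm (z w : Circle) : circleNorm (z / w) = circleNorm (w / z) := by
  rw [← circleNorm_inv, inv_div]

lemma circleNorm_le_add_div (z w : Circle) : circleNorm z ≤ circleNorm w + circleNorm (z / w) := by
  simpa using circleNorm_mul_le w (z / w)

lemma dist_eq_circleNorm (z w : Circle) : dist z w = circleNorm (z / w) := by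
  have h : (z : ℂ) - w = w * ((z / w : Circle) - 1) := by
    push_cast
    have := w.coe_ne_zero
    field_simp
  have hd : dist z w = ‖(z : ℂ) - w‖ := dist_eq_norm (z : ℂ) w
  rw [hd, h, circleNorm, norm_mul, Circle.norm_coe, one_mul]

lemma continuous_circleNorm : Continuous circleNorm := by
  unfold circleNorm; fun_prop

lemma mem_circlePos_of_circleNorm_le_one {z : Circle} (h : circleNorm z ≤ 1) :
    z ∈ circlePos := by
  have h1 := (Complex.abs_re_le_norm ((z : ℂ) - 1)).trans h
  rw [Complex.sub_re, Complex.one_re, abs_le] at h1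
  change 0 ≤ (z : ℂ).re
  linarith [h1.1]

/-- Factor `z² - 1 = (z - 1)(z + 1)`; on the right half circle `|z + 1|² = 2 + 2 Re z ≥ 2`. -/
lemma two_mul_circleNorm_sq_le {z : Circle} (h : z ∈ circlePos) :
    2 * circleNorm z ^ 2 ≤ circleNorm (z ^ 2) ^ 2 := by
  have h0 : 0 ≤ (z : ℂ).re := h
  have h1 : ((z ^ 2 : Circle) : ℂ) - 1 = (z - 1) * (z + 1) := by push_cast; ring
  have h2 : 2 ≤ ‖(z : ℂ) + 1‖ ^ 2 := by
    have h3 := z.normSq_coe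
    rw [← Complex.normSq_eq_norm_sq]
    rw [Complex.normSq_apply] at h3 ⊢
    simp only [Complex.add_re, Complex.one_re, Complex.add_im, Complex.one_im]
    nlinarith
  unfold circleNorm
  rw [h1, norm_mul, mul_pow]
  nlinarith [sq_nonneg ‖(z : ℂ) - 1‖]

lemma two_pow_mul_circleNorm_sq_le {z : Circle} {m : ℕ}
    (h : ∀ i < m, z ^ 2 ^ i ∈ circlePos) : 2 ^ m * circleNorm z ^ 2 ≤ 4 := by
  have key : ∀ k ≤ m, 2 ^ k * circleNorm z ^ 2 ≤ circleNorm (z ^ 2 ^ k) ^ 2 := by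
    intro k
    induction k with
    | zero => simp
    | succ k ih =>
      intro hk
      have h1 := two_mul_circleNorm_sq_le (h k (by omega))
      rw [← pow_mul, ← pow_succ] at h1
      have h2 := ih (by omega)
      rw [pow_succ]
      linarith
  refine (key m le_rfl).trans ?_
  have h1 := circleNorm_le_two (z ^ 2 ^ m)
  have h2 := circleNorm_nonneg (z ^ 2 ^ m)
  nlinarith

/-- Each squaring inside `𝕋₊` expands the distance to `1` by at least `√2`, while distances never
exceed `2`. -/
lemma eq_one_of_forall_pow_mem_circlePos {z : Circle} (h : ∀ n : ℕ, z ^ n ∈ circlePos) :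
    z = 1 := by
  by_contra hz
  have h0 : 0 < circleNorm z ^ 2 :=
    pow_pos ((circleNorm_nonneg z).lt_of_ne fun h ↦ hz (circleNorm_eq_zero.1 h.symm)) 2
  obtain ⟨m, hm⟩ := pow_unbounded_of_one_lt (4 / circleNorm z ^ 2) one_lt_two
  rw [div_lt_iff₀ h0] at hm
  exact (two_pow_mul_circleNorm_sq_le (m := m) fun i _ ↦ h _).not_gt hm

lemma circleNorm_exp_le (t : ℝ) : circleNorm (Circle.exp t) ≤ |t| := by
  have := Real.norm_exp_I_mul_ofReal_sub_one_le (x := t)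
  rw [circleNorm, Circle.coe_exp, mul_comm]
  simpa using this

lemma circleNorm_le_abs_arg (z : Circle) : circleNorm z ≤ |Complex.arg z| := by
  conv_lhs => rw [← Circle.exp_arg z]
  exact circleNorm_exp_le _

/-- Every point of the circle has a `q`-th root close to `1`. -/
lemma exists_pow_eq_circleNorm_le (z : Circle) {q : ℕ} (hq : 0 < q) :
    ∃ r : Circle, r ^ q = z ∧ circleNorm r ≤ Real.pi / q := by
  have hq' : (q : ℝ) ≠ 0 := by positivity
  refine ⟨Circle.exp (Complex.arg z / q), ?_, ?_⟩
  · rw [← Circle.exp_natCast_mul, mul_div_cancel₀ _ hq', Circle.exp_arg]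
  · refine (circleNorm_exp_le _).trans ?_
    rw [abs_div, Nat.abs_cast]
    gcongr
    exact Complex.abs_arg_le_pi _

/-! ### Extending characters and separating points -/

noncomputable instance : DivisibleBy (Additive Circle) ℤ where
  div z n := Additive.ofMul (Circle.exp (Complex.arg (z.toMul : Circle) / n))
  div_zero z := by simp
  div_cancel {n} z hn := by
    have hn' : (n : ℝ) ≠ 0 := by exact_mod_cast hn
    rw [← ofMul_zpow, ← Circle.exp_intCast_mul, mul_div_cancel₀ _ hn', Circle.exp_arg]
    rfl

variable {G : Type*} [AddCommGroup G]

/-- Characters of a subgroup extend to the whole group. -/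
lemma exists_addChar_extension (H : AddSubgroup G) (χ : AddChar H Circle) :
    ∃ θ : AddChar G Circle, ∀ x : H, θ x = χ x := by
  obtain ⟨f, hf⟩ := (Module.Baer.of_divisible (Additive Circle)).extension_property_addMonoidHom
    H.subtype H.subtype_injective χ.toAddMonoidHom
  refine ⟨AddChar.toAddMonoidHomEquiv.symm f, fun x ↦ ?_⟩
  exact congrArg Additive.toMul (DFunLike.congr_fun hf x)

lemma exists_addChar_apply_ne_one {x : G} (hx : x ≠ 0) : ∃ χ : AddChar G Circle, χ x ≠ 1 := by
  obtain ⟨c, hc⟩ := CharacterModule.exists_character_apply_ne_zero_of_ne_zero hx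
  let e : ℚ →+ Additive Circle :=
    { toFun := fun q ↦ Additive.ofMul (Circle.exp (2 * Real.pi * q))
      map_zero' := by simp
      map_add' := fun a b ↦ by
        rw [← ofMul_mul, ← Circle.exp_add]; push_cast; ring_nf }
  have he : ∀ q, e q = 0 ↔ q ∈ AddSubgroup.zmultiples (1 : ℚ) := by
    intro q
    change Circle.exp (2 * Real.pi * q) = 1 ↔ _
    rw [Circle.exp_eq_one, AddSubgroup.mem_zmultiples_iff]
    refine exists_congr fun n ↦ ?_
    have := Real.pi_pos
    rw [zsmul_one, mul_comm (n : ℝ), mul_right_inj' (by positivity), eq_comm]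
    norm_cast
  let E : AddCircle (1 : ℚ) →+ Additive Circle :=
    QuotientAddGroup.lift (AddSubgroup.zmultiples (1 : ℚ)) e fun q hq ↦ (he q).2 hq
  refine ⟨AddChar.toAddMonoidHomEquiv.symm (E.comp c), fun h ↦ hc ?_⟩
  have h1 : E (c x) = 0 := congrArg Additive.ofMul h
  generalize c x = y at h1
  induction y using QuotientAddGroup.induction_on with
  | H q => exact (QuotientAddGroup.eq_zero_iff q).2 ((he q).1 h1)

lemma exists_addChar_eq_one_on_apply_ne_one {H : AddSubgroup G} {x : G} (hx : x ∉ H) :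
    ∃ χ : AddChar G Circle, (∀ y ∈ H, χ y = 1) ∧ χ x ≠ 1 := by
  obtain ⟨χ, hχ⟩ := exists_addChar_apply_ne_one
    (fun h ↦ hx ((QuotientAddGroup.eq_zero_iff x).1 h) : (x : G ⧸ H) ≠ 0)
  refine ⟨χ.compAddMonoidHom (QuotientAddGroup.mk' H), fun y hy ↦ ?_, by simpa using hχ⟩
  have : (y : G ⧸ H) = 0 := (QuotientAddGroup.eq_zero_iff y).2 hy
  simp [this]

/-! ### Continuity of characters and norm topologies -/

/-- A character which is continuous at `0` is continuous. -/
lemma mem_dual_of_eventually {τ : TopologicalSpace G} (hτ : @IsTopologicalAddGroup G τ _)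
    {χ : AddChar G Circle}
    (h : ∀ ε > 0, ∀ᶠ x in @nhds G τ 0, circleNorm (χ x) < ε) : χ ∈ dual τ := by
  let := τ
  have := hτ
  change Continuous χ
  have h0 : ContinuousAt χ.toAddMonoidHom 0 := by
    change Filter.Tendsto χ (nhds 0) (nhds (χ 0))
    rw [χ.map_zero_eq_one]
    refine Metric.tendsto_nhds.2 fun ε hε ↦ (h ε hε).mono fun x hx ↦ ?_
    rwa [dist_eq_circleNorm, div_one]
  exact continuous_of_continuousAt_zero χ.toAddMonoidHom h0

lemma eventually_circleNorm_lt {τ : TopologicalSpace G} {χ : AddChar G Circle} (hχ : χ ∈ dual τ)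
    {ε : ℝ} (hε : 0 < ε) : ∀ᶠ x in @nhds G τ 0, circleNorm (χ x) < ε := by
  let := τ
  have hc : Continuous χ := hχ
  have h : Filter.Tendsto (fun x ↦ circleNorm (χ x)) (nhds 0) (nhds (circleNorm (χ 0))) :=
    (continuous_circleNorm.comp hc).tendsto 0
  rw [χ.map_zero_eq_one, circleNorm_one] at h
  exact h.eventually (gt_mem_nhds hε)

/-- The topology on an additive group given by a norm. -/
abbrev normTopology (N : AddGroupNorm G) : TopologicalSpace G :=
  N.toNormedAddCommGroup.toSeminormedAddCommGroup.toPseudoMetricSpace.toUniformSpace.toTopologicalSpace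

lemma isTopologicalAddGroup_normTopology (N : AddGroupNorm G) :
    @IsTopologicalAddGroup G (normTopology N) _ := by
  let := N.toNormedAddCommGroup
  exact (inferInstance : IsTopologicalAddGroup G)

lemma metrizableSpace_normTopology (N : AddGroupNorm G) :
    @TopologicalSpace.MetrizableSpace G (normTopology N) := by
  let := N.toNormedAddCommGroup
  exact (inferInstance : TopologicalSpace.MetrizableSpace G)

lemma mem_nhds_normTopology {N : AddGroupNorm G} {U : Set G} :
    U ∈ @nhds G (normTopology N) 0 ↔ ∃ ε > 0, ∀ x, N x < ε → x ∈ U := by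
  let := N.toNormedAddCommGroup
  have h := (Metric.nhds_basis_ball (x := (0 : G))).mem_iff (t := U)
  refine h.trans (exists_congr fun ε ↦ and_congr_right fun _ ↦ ?_)
  refine forall_congr' fun x ↦ ?_
  rw [Metric.mem_ball, dist_zero_right]
  rfl

/-! ### Locally quasi-convex topologies from weighted suprema of characters -/

section

variable {ι : Type*} (H : AddSubgroup G) (θ : ι → AddChar G Circle) (w : ι → ℝ)

open Classical in
/-- The function `x ↦ sup_i w_i |θ_i x - 1|` on the subgroup `H`, extended by the value `2`. -/
noncomputable def weightedSup (x : G) : ℝ :=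
  -- For weights at most `1` the supremum is at most `2`, so the triangle inequality survives
  -- outside `H`, while the open ball of radius `2` lies in `H` and makes `H` open.
  if x ∈ H then ⨆ i, w i * circleNorm (θ i x) else 2

variable {H θ w}

lemma bddAbove_weighted (hw1 : ∀ i, w i ≤ 1) (x : G) :
    BddAbove (Set.range fun i ↦ w i * circleNorm (θ i x)) := by
  refine ⟨2, ?_⟩
  rintro _ ⟨i, rfl⟩
  have h1 := circleNorm_nonneg (θ i x)
  have h2 := circleNorm_le_two (θ i x)
  have h3 := hw1 i
  change w i * circleNorm (θ i x) ≤ 2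
  nlinarith

lemma le_weightedSup (hw1 : ∀ i, w i ≤ 1) {x : G} (hx : x ∈ H) (i : ι) :
    w i * circleNorm (θ i x) ≤ weightedSup H θ w x := by
  rw [weightedSup, if_pos hx]
  exact le_ciSup (bddAbove_weighted hw1 x) i

lemma weightedSup_le {x : G} (hx : x ∈ H) {a : ℝ} (ha : 0 ≤ a)
    (h : ∀ i, w i * circleNorm (θ i x) ≤ a) : weightedSup H θ w x ≤ a := by
  rw [weightedSup, if_pos hx]
  exact Real.iSup_le h ha

lemma weightedSup_le_two (hw1 : ∀ i, w i ≤ 1) (x : G) : weightedSup H θ w x ≤ 2 := by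
  by_cases hx : x ∈ H
  · refine weightedSup_le hx zero_le_two fun i ↦ ?_
    have h1 := circleNorm_nonneg (θ i x)
    have h2 := circleNorm_le_two (θ i x)
    have h3 := hw1 i
    nlinarith
  · rw [weightedSup, if_neg hx]

lemma weightedSup_nonneg (hw : ∀ i, 0 < w i) (x : G) : 0 ≤ weightedSup H θ w x := by
  unfold weightedSup
  split_ifs
  · exact Real.iSup_nonneg fun i ↦ mul_nonneg (hw i).le (circleNorm_nonneg _)
  · exact zero_le_two

lemma mem_of_weightedSup_lt {x : G} (h : weightedSup H θ w x < 2) : x ∈ H := by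
  by_contra hx
  rw [weightedSup, if_neg hx] at h
  exact h.false

/-- The group norm with values `sup_i w_i |θ_i x - 1|` on `H`. -/
noncomputable def weightedNorm (hw : ∀ i, 0 < w i) (hw1 : ∀ i, w i ≤ 1)
    (hsep : ∀ x ∈ H, (∀ i, θ i x = 1) → x = 0) : AddGroupNorm G where
  toFun := weightedSup H θ w
  map_zero' := by
    refine le_antisymm (weightedSup_le H.zero_mem le_rfl fun i ↦ ?_) (weightedSup_nonneg hw 0)
    simp [circleNorm_one]
  add_le' x y := by
    by_cases hx : x ∈ H
    · by_cases hy : y ∈ H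
      · refine weightedSup_le (H.add_mem hx hy)
          (add_nonneg (weightedSup_nonneg hw x) (weightedSup_nonneg hw y)) fun i ↦ ?_
        rw [AddChar.map_add_eq_mul]
        have h1 := mul_le_mul_of_nonneg_left (circleNorm_mul_le (θ i x) (θ i y)) (hw i).le
        linarith [le_weightedSup (θ := θ) hw1 hx i, le_weightedSup (θ := θ) hw1 hy i]
      · have h1 : weightedSup H θ w y = 2 := if_neg hy
        linarith [weightedSup_nonneg (H := H) (θ := θ) hw x,
          weightedSup_le_two (H := H) (θ := θ) hw1 (x + y)]
    · have h1 : weightedSup H θ w x = 2 := if_neg hx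
      linarith [weightedSup_nonneg (H := H) (θ := θ) hw y,
        weightedSup_le_two (H := H) (θ := θ) hw1 (x + y)]
  neg' x := by
    by_cases hx : x ∈ H <;> simp [weightedSup, hx, AddChar.map_neg_eq_inv, circleNorm_inv]
  eq_zero_of_map_eq_zero' x h := by
    have hx : x ∈ H := mem_of_weightedSup_lt (by rw [h]; exact zero_lt_two)
    refine hsep x hx fun i ↦ circleNorm_eq_zero.1 (le_antisymm ?_ (circleNorm_nonneg _))
    have h1 := le_weightedSup (θ := θ) hw1 hx i
    rw [h] at h1
    exact nonpos_of_mul_nonpos_right h1 (hw i)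

variable (hw : ∀ i, 0 < w i) (hw1 : ∀ i, w i ≤ 1) (hsep : ∀ x ∈ H, (∀ i, θ i x = 1) → x = 0)

lemma mem_dual_weightedNorm (i : ι) : θ i ∈ dual (normTopology (weightedNorm hw hw1 hsep)) := by
  refine mem_dual_of_eventually (isTopologicalAddGroup_normTopology _) fun ε hε ↦ ?_
  refine mem_nhds_normTopology.2 ⟨min 2 (w i * ε), lt_min zero_lt_two (mul_pos (hw i) hε), ?_⟩
  intro x hx
  obtain ⟨h1, h2⟩ := lt_min_iff.1 hx
  exact lt_of_mul_lt_mul_left ((le_weightedSup hw1 (mem_of_weightedSup_lt h1) i).trans_lt h2)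
    (hw i).le

lemma mem_dual_weightedNorm_of_eq_one {χ : AddChar G Circle} (hχ : ∀ x ∈ H, χ x = 1) :
    χ ∈ dual (normTopology (weightedNorm hw hw1 hsep)) := by
  refine mem_dual_of_eventually (isTopologicalAddGroup_normTopology _) fun ε hε ↦ ?_
  refine mem_nhds_normTopology.2 ⟨2, zero_lt_two, fun x hx ↦ ?_⟩
  change circleNorm (χ x) < ε
  rwa [hχ x (mem_of_weightedSup_lt hx), circleNorm_one]

lemma pow_mem_dual {τ : TopologicalSpace G} {χ : AddChar G Circle} (hχ : χ ∈ dual τ) (n : ℕ) :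
    χ ^ n ∈ dual τ := by
  let := τ
  have h : Continuous χ := hχ
  exact h.pow n

/-- A set which is the common preimage of `circlePos` under continuous characters is
quasi-convex. -/
lemma isQuasiConvex_setOf {τ : TopologicalSpace G} {S : Set (AddChar G Circle)}
    (hS : S ⊆ dual τ) : IsQuasiConvex τ {x | ∀ χ ∈ S, χ x ∈ circlePos} := by
  intro x hx
  simp only [Set.mem_ofPred_eq, not_forall] at hx
  obtain ⟨χ, hχ, hx⟩ := hx
  exact ⟨χ, hS hχ, fun y hy ↦ hy χ hχ, hx⟩

/-- Only the `θ i` of weight at least `ε / 4` matter, and finitely many of their dyadic powers lying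
in `𝕋₊` force `θ i x` near `1`. The number `m` of powers is uniform in `i`, so the polar of `S` is
still a neighbourhood of `0`. -/
lemma isLocallyQuasiConvex_weightedNorm :
    IsLocallyQuasiConvex (normTopology (weightedNorm hw hw1 hsep)) := by
  intro U hU
  obtain ⟨ε, hε, hU⟩ := mem_nhds_normTopology.1 hU
  obtain ⟨m, hm⟩ := pow_unbounded_of_one_lt (16 / ε ^ 2) one_lt_two
  rw [div_lt_iff₀ (by positivity)] at hm
  let S : Set (AddChar G Circle) := {χ | (∀ x ∈ H, χ x = 1) ∨
    ∃ i, ε / 4 ≤ w i ∧ ∃ j < m, χ = θ i ^ 2 ^ j}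
  refine ⟨{x | ∀ χ ∈ S, χ x ∈ circlePos}, mem_nhds_normTopology.2
    ⟨min 2 (ε / 4 / 2 ^ m), by positivity, ?_⟩, isQuasiConvex_setOf ?_, ?_⟩
  · intro x hx χ hχ
    obtain ⟨h1, h2⟩ := lt_min_iff.1 hx
    have hxH : x ∈ H := mem_of_weightedSup_lt h1
    apply mem_circlePos_of_circleNorm_le_one
    rcases hχ with hχ | ⟨i, hi, j, hj, rfl⟩
    · rw [hχ x hxH, circleNorm_one]; exact zero_le_one
    · rw [AddChar.pow_apply]
      refine (circleNorm_pow_le _ _).trans ?_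
      have h3 := (le_weightedSup (θ := θ) hw1 hxH i).trans_lt h2
      have h4 : circleNorm (θ i x) ≤ 1 / 2 ^ m := by
        have h5 := mul_le_mul_of_nonneg_right hi (circleNorm_nonneg (θ i x))
        have h6 : ε / 4 * circleNorm (θ i x) < ε / 4 * (1 / 2 ^ m) := by
          rw [mul_one_div]; linarith
        exact (lt_of_mul_lt_mul_left h6 (by positivity)).le
      have h5 : ((2 ^ j : ℕ) : ℝ) ≤ 2 ^ m := by
        push_cast
        exact pow_le_pow_right₀ one_le_two hj.le
      calc ((2 ^ j : ℕ) : ℝ) * circleNorm (θ i x) ≤ 2 ^ m * (1 / 2 ^ m) :=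
            mul_le_mul h5 h4 (circleNorm_nonneg _) (by positivity)
        _ = 1 := by field_simp
  · rintro χ (hχ | ⟨i, -, j, -, rfl⟩)
    · exact mem_dual_weightedNorm_of_eq_one hw hw1 hsep hχ
    · exact pow_mem_dual (mem_dual_weightedNorm hw hw1 hsep i) _
  · intro x hx
    have hxH : x ∈ H := by
      by_contra hxH
      -- All powers of a character killing `H` belong to `S`, so the polar of `S` stays inside `H`.
      obtain ⟨χ, hχ, hχx⟩ := exists_addChar_eq_one_on_apply_ne_one hxH
      refine hχx (eq_one_of_forall_pow_mem_circlePos fun n ↦ ?_)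
      rw [← AddChar.pow_apply]
      refine hx _ (Or.inl fun y hy ↦ ?_)
      rw [AddChar.pow_apply, hχ y hy, one_pow]
    apply hU
    refine (weightedSup_le hxH (by positivity : 0 ≤ ε / 2) fun i ↦ ?_).trans_lt (by linarith)
    have h1 := circleNorm_nonneg (θ i x)
    by_cases hi : ε / 4 ≤ w i
    · have h2 : 2 ^ m * circleNorm (θ i x) ^ 2 ≤ 4 :=
        two_pow_mul_circleNorm_sq_le fun j hj ↦ by
          rw [← AddChar.pow_apply]
          exact hx _ (Or.inr ⟨i, hi, j, hj, rfl⟩)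
      have h3 : circleNorm (θ i x) ≤ ε / 2 := by
        by_contra! h4
        have h5 : (ε / 2) ^ 2 < circleNorm (θ i x) ^ 2 := by gcongr
        have h6 := mul_le_mul_of_nonneg_left h5.le (by positivity : (0 : ℝ) ≤ 2 ^ m)
        nlinarith
      nlinarith [hw1 i]
    · push Not at hi
      have h2 := circleNorm_le_two (θ i x)
      nlinarith [hw i]

lemma isLqcGroupTopology_weightedNorm :
    IsLqcGroupTopology (normTopology (weightedNorm hw hw1 hsep)) where
  isTopologicalAddGroup := isTopologicalAddGroup_normTopology _
  t2Space := by
    let := (weightedNorm hw hw1 hsep).toNormedAddCommGroup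
    exact (inferInstance : T2Space G)
  isLocallyQuasiConvex := isLocallyQuasiConvex_weightedNorm hw hw1 hsep

end

/-! ### The gliding hump -/

lemma abs_arg_le_pi_div_two {z : Circle} (h : circleNorm z ≤ 1) :
    |Complex.arg z| ≤ Real.pi / 2 :=
  Complex.abs_arg_le_pi_div_two_iff.2 (mem_circlePos_of_circleNorm_le_one h)

lemma arg_mul_of_circleNorm_le_one {z w : Circle} (hz : circleNorm z ≤ 1) (hw : circleNorm w ≤ 1)
    (hz0 : 0 ≤ Complex.arg z) (hw0 : 0 ≤ Complex.arg w) :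
    Complex.arg (z * w : Circle) = Complex.arg z + Complex.arg w := by
  have h1 := (le_abs_self _).trans (abs_arg_le_pi_div_two hz)
  have h2 := (le_abs_self _).trans (abs_arg_le_pi_div_two hw)
  rw [Circle.coe_mul]
  exact Complex.arg_mul z.coe_ne_zero w.coe_ne_zero
    ⟨by linarith [Real.pi_pos], by linarith⟩

/-- The sequence of characters `χ` converges pointwise to `1` on `H`. -/
def TendsToOneOn (H : AddSubgroup G) (χ : ℕ → AddChar G Circle) : Prop :=
  ∀ x ∈ H, ∀ ε > 0, ∃ N, ∀ n ≥ N, circleNorm (χ n x) < ε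

/-- The finitely supported sequences of the torus are uniform limits of the sequences
`(χ_n x)_n`, `x ∈ H`, where moreover `x` may be taken close to `0` for finitely many `ψ_i`. -/
def ApproximatesFiniteSequences (H : AddSubgroup G) (χ ψ : ℕ → AddChar G Circle) : Prop :=
  ∀ (N : ℕ) (t : ℕ → Circle), ∀ ε > 0, ∃ x ∈ H, (∀ n < N, circleNorm (χ n x / t n) < ε) ∧
    (∀ n ≥ N, circleNorm (χ n x) < ε) ∧ ∀ i < N, circleNorm (ψ i x) < ε

/-- Continuity at `0` for the topology of uniform convergence on `χ` and pointwise convergence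
on `ψ`. -/
def UniformlyContinuousOn (H : AddSubgroup G) (χ ψ : ℕ → AddChar G Circle)
    (φ : AddChar G Circle) : Prop :=
  ∀ ε > 0, ∃ δ > 0, ∃ N : ℕ, ∀ x ∈ H, (∀ n, circleNorm (χ n x) < δ) →
    (∀ i < N, circleNorm (ψ i x) < δ) → circleNorm (φ x) < ε

variable {H : AddSubgroup G} {χ ψ : ℕ → AddChar G Circle} {φ : AddChar G Circle}

/-- Produces one hump: `u` is uniformly small along `χ`, essentially supported on `[M, M')`, yet `φ
u` stays away from `1`. It is an approximate `q`-th part of a witness `x` that `φ` is not pointwise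
continuous: `x - q • u` is uniformly small, so `φ (q • u)` inherits at least `ε / 2` from `φ x`. -/
lemma exists_block (h1 : TendsToOneOn H χ) (h2 : ApproximatesFiniteSequences H χ ψ)
    (hφ : UniformlyContinuousOn H χ ψ φ) {ε : ℝ} (hε : 0 < ε)
    (hneg : ∀ δ > 0, ∀ N : ℕ, ∃ x ∈ H, (∀ n < N, circleNorm (χ n x) < δ) ∧
      (∀ i < N, circleNorm (ψ i x) < δ) ∧ ε ≤ circleNorm (φ x))
    {q : ℕ} (hq : 0 < q) (M : ℕ) {η : ℝ} (hη : 0 < η) :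
    ∃ u ∈ H, ∃ M' ≥ M, (∀ n < M, circleNorm (χ n u) < η) ∧ (∀ n ≥ M', circleNorm (χ n u) < η) ∧
      (∀ n, circleNorm (χ n u) < Real.pi / q + η) ∧ (∀ i < M, circleNorm (ψ i u) < η) ∧
      ε / 2 / q ≤ circleNorm (φ u) := by
  obtain ⟨δ, hδ, N, hN⟩ := hφ (ε / 2) (by positivity)
  obtain ⟨x, hx, hx1, hx2, hx3⟩ := hneg (δ / 2) (by positivity) (max M N)
  obtain ⟨L, hL⟩ := h1 x hx (δ / 2) (by positivity)
  choose r hr1 hr2 using fun z ↦ exists_pow_eq_circleNorm_le z hq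
  have hq' : (0 : ℝ) < q := by exact_mod_cast hq
  have hpq : 0 ≤ Real.pi / q := by positivity
  -- Roots are prescribed only up to `max L (max M N)`; beyond it `χ n x` is already small, and
  -- below `max M N` it is small by the choice of `x`.
  let t : ℕ → Circle := fun n ↦ if n < max M N then 1 else r (χ n x)
  have ht : ∀ n, circleNorm (t n) ≤ Real.pi / q := by
    intro n
    by_cases hn : n < max M N
    · simp only [t, if_pos hn, circleNorm_one]; exact hpq
    · simp only [t, if_neg hn]; exact hr2 _
  obtain ⟨u, hu, hu1, hu2, hu3⟩ := h2 (max L (max M N)) t (min η (δ / 2 / q)) (by positivity)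
  have hmul : ∀ (θ : AddChar G Circle), circleNorm (θ u) < min η (δ / 2 / q) →
      circleNorm (θ x) < δ / 2 → circleNorm (θ (x - q • u)) < δ := by
    intro θ hθ hθx
    have h3 := circleNorm_div_le (θ x) (θ u ^ q)
    have h4 := circleNorm_pow_le (θ u) q
    have h5 : q * circleNorm (θ u) < δ / 2 := by
      rw [mul_comm, ← lt_div_iff₀ hq']
      exact hθ.trans_le (min_le_right _ _)
    rw [AddChar.map_sub_eq_div, AddChar.map_nsmul_eq_pow]
    linarith
  have hsmall : ∀ n < max M N, circleNorm (χ n u) < min η (δ / 2 / q) := by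
    intro n hn
    have h3 := hu1 n (lt_max_of_lt_right hn)
    simpa only [t, if_pos hn, div_one] using h3
  refine ⟨u, hu, max L (max M N), le_max_of_le_right (le_max_left _ _), fun n hn ↦ ?_,
    fun n hn ↦ (hu2 n hn).trans_le (min_le_left _ _), fun n ↦ ?_, fun i hi ↦ ?_, ?_⟩
  · exact (hsmall n (lt_max_of_lt_left hn)).trans_le (min_le_left _ _)
  · by_cases hn : n < max L (max M N)
    · refine (circleNorm_le_add_div _ (t n)).trans_lt ?_
      exact add_lt_add_of_le_of_lt (ht n) ((hu1 n hn).trans_le (min_le_left _ _))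
    · have := (hu2 n (not_lt.1 hn)).trans_le (min_le_left _ _)
      linarith
  · exact (hu3 i (lt_max_of_lt_right (lt_max_of_lt_left hi))).trans_le (min_le_left _ _)
  · have hz : circleNorm (φ (x - q • u)) < ε / 2 := by
      refine hN _ (H.sub_mem hx (H.nsmul_mem hu q)) (fun n ↦ ?_) (fun i hi ↦ ?_)
      · by_cases hn : n < max M N
        · exact hmul _ (hsmall n hn) (hx1 n hn)
        · by_cases hn' : n < max L (max M N)
          · have h3 := (hu1 n hn').trans_le (min_le_right _ _)
            rw [circleNorm_div_comm, lt_div_iff₀ hq'] at h3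
            have h4 : χ n (x - q • u) = (t n / χ n u) ^ q := by
              simp only [t, if_neg hn]
              rw [div_pow, hr1, AddChar.map_sub_eq_div, AddChar.map_nsmul_eq_pow]
            rw [h4]
            have h5 := circleNorm_pow_le (t n / χ n u) q
            linarith
          · have hn'' := not_lt.1 hn'
            exact hmul _ (hu2 n hn'') (hL n ((le_max_left _ _).trans hn''))
      · have hi' : i < max M N := lt_max_of_lt_right hi
        exact hmul _ (hu3 i (lt_max_of_lt_right hi')) (hx2 i hi')
    have h3 := circleNorm_le_add_div (φ x) (φ (q • u))
    rw [← AddChar.map_sub_eq_div, AddChar.map_nsmul_eq_pow] at h3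
    have h4 := circleNorm_pow_le (φ u) q
    rw [div_le_iff₀ hq']
    linarith

/-- Under density of the finitely supported sequences, continuity for the topology of uniform
convergence on `χ` implies continuity for the topology of pointwise convergence. -/
theorem pointwise_continuous_of_uniformlyContinuousOn (h1 : TendsToOneOn H χ)
    (h2 : ApproximatesFiniteSequences H χ ψ) (hφ : UniformlyContinuousOn H χ ψ φ)
    {ε : ℝ} (hε : 0 < ε) :
    ∃ δ > 0, ∃ N : ℕ, ∀ x ∈ H, (∀ n < N, circleNorm (χ n x) < δ) →
      (∀ i < N, circleNorm (ψ i x) < δ) → circleNorm (φ x) < ε := by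
  by_contra! hneg
  obtain ⟨δ, hδ, N, hN⟩ := hφ 1 one_pos
  -- Humps have height about `π / q < δ / 2`. Adding `R` of them with essentially disjoint supports
  -- costs only errors `R * η < δ / 2`, so the sum stays below `δ`, where `φ` is within `1` of `1`;
  -- but the arguments under `φ` add up to `R * c > π / 2`.
  obtain ⟨q, hq⟩ := exists_nat_gt (Real.pi / (δ / 2))
  have hq' : (0 : ℝ) < q := (div_pos Real.pi_pos (by positivity)).trans hq
  have hpq : Real.pi / q < δ / 2 := by
    rw [div_lt_iff₀ (by positivity)] at hq
    rw [div_lt_iff₀ hq']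
    linarith
  have hpq0 : 0 < Real.pi / q := div_pos Real.pi_pos hq'
  set c := ε / 2 / q with hc
  have hc0 : 0 < c := by positivity
  obtain ⟨R, hR⟩ := exists_nat_gt (Real.pi / 2 / c)
  rw [div_lt_iff₀ hc0] at hR
  set η := δ / 2 / (R + 1) with hη
  have hη0 : 0 < η := by positivity
  have hrη : ∀ r ≤ R, r * η < δ / 2 := by
    intro r hr
    have h3 : (r : ℝ) ≤ R := by exact_mod_cast hr
    have h4 : (R + 1) * η = δ / 2 := by rw [hη]; field_simp
    nlinarith
  have key : ∀ r ≤ R, ∃ v ∈ H, ∃ L : ℕ, (∀ n, circleNorm (χ n v) ≤ Real.pi / q + r * η) ∧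
      (∀ n ≥ L, circleNorm (χ n v) ≤ r * η) ∧ (∀ i < N, circleNorm (ψ i v) ≤ r * η) ∧
      r * c ≤ Complex.arg (φ v) ∧ circleNorm (φ v) ≤ 1 := by
    intro r
    induction r with
    | zero =>
      intro _
      refine ⟨0, H.zero_mem, 0, ?_⟩
      simp [circleNorm_one, hpq0.le]
    | succ r ih =>
      intro hr
      obtain ⟨v, hv, L, hv1, hv2, hv3, hv4, hv5⟩ := ih (by omega)
      obtain ⟨u, hu, M, hM, hu1, hu2, hu3, hu4, hu5, hu6⟩ : ∃ u ∈ H, ∃ M ≥ max L N,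
          (∀ n < max L N, circleNorm (χ n u) < η) ∧ (∀ n ≥ M, circleNorm (χ n u) < η) ∧
          (∀ n, circleNorm (χ n u) < Real.pi / q + η) ∧
          (∀ i < max L N, circleNorm (ψ i u) < η) ∧
          c ≤ circleNorm (φ u) ∧ 0 ≤ Complex.arg (φ u) := by
        obtain ⟨u, hu, M, hM, hu1, hu2, hu3, hu4, hu5⟩ := exists_block h1 h2 hφ hε
          (fun δ hδ N ↦ hneg δ hδ N) (Nat.cast_pos.1 hq') (max L N) hη0
        -- Replacing `u` by `-u` if needed keeps the arguments from cancelling.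
        rcases le_total 0 (Complex.arg (φ u)) with h | h
        · exact ⟨u, hu, M, hM, hu1, hu2, hu3, hu4, hu5, h⟩
        · refine ⟨-u, H.neg_mem hu, M, hM, ?_⟩
          simp only [AddChar.map_neg_eq_inv, circleNorm_inv]
          refine ⟨hu1, hu2, hu3, hu4, hu5, ?_⟩
          rw [Circle.coe_inv, Complex.arg_inv]
          split_ifs
          · exact Real.pi_pos.le
          · linarith
      have hη1 : η < δ / 2 := by
        have := hrη 1 (by omega)
        simpa using this
      have hφu : circleNorm (φ u) ≤ 1 := by
        refine (hN u hu (fun n ↦ ?_) fun i hi ↦ ?_).le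
        · linarith [hu3 n]
        · linarith [hu4 i (lt_max_of_lt_right hi)]
      have hχ : ∀ n, circleNorm (χ n (v + u)) ≤ Real.pi / q + (r + 1 : ℕ) * η := by
        intro n
        rw [AddChar.map_add_eq_mul]
        refine (circleNorm_mul_le _ _).trans ?_
        push_cast
        by_cases hn : n < max L N
        · linarith [hv1 n, hu1 n hn]
        · linarith [hv2 n ((le_max_left _ _).trans (not_lt.1 hn)), hu3 n]
      have hψ : ∀ i < N, circleNorm (ψ i (v + u)) ≤ (r + 1 : ℕ) * η := by
        intro i hi
        rw [AddChar.map_add_eq_mul]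
        refine (circleNorm_mul_le _ _).trans ?_
        push_cast
        linarith [hv3 i hi, hu4 i (lt_max_of_lt_right hi)]
      refine ⟨v + u, H.add_mem hv hu, M, hχ, fun n hn ↦ ?_, hψ, ?_, ?_⟩
      · rw [AddChar.map_add_eq_mul]
        refine (circleNorm_mul_le _ _).trans ?_
        push_cast
        linarith [hv2 n (((le_max_left _ _).trans hM).trans hn), hu2 n hn]
      · rw [AddChar.map_add_eq_mul, arg_mul_of_circleNorm_le_one hv5 hφu
          (le_trans (by positivity) hv4) hu6]
        have h3 := circleNorm_le_abs_arg (φ u)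
        rw [abs_of_nonneg hu6] at h3
        push_cast
        linarith
      · have h3 := hrη (r + 1) hr
        refine (hN _ (H.add_mem hv hu) (fun n ↦ ?_) fun i hi ↦ ?_).le
        · linarith [hχ n]
        · linarith [hψ i hi]
  obtain ⟨v, -, -, -, -, -, h4, h5⟩ := key R le_rfl
  exact (hR.trans_le (h4.trans ((le_abs_self _).trans (abs_arg_le_pi_div_two h5)))).false

/-! ### Two distinct topologies with the same dual -/

/-- Existence of such a system of characters yields a metrizable locally quasi-convex group
topology which is not Mackey. -/
theorem not_satisfiesVaropoulosParadigm (h1 : TendsToOneOn H χ)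
    (h2 : ApproximatesFiniteSequences H χ ψ) (hsep : ∀ x ∈ H, (∀ i, ψ i x = 1) → x = 0) :
    ¬ SatisfiesVaropoulosParadigm G := by
  intro hG
  let θ : ℕ ⊕ ℕ → AddChar G Circle := Sum.elim χ ψ
  -- Decaying weights `a` encode pointwise convergence on `H`; the constant weight `1` on `χ` in `b`
  -- encodes uniform convergence.
  let a : ℕ ⊕ ℕ → ℝ := Sum.elim (fun n ↦ (1 / 2) ^ n) (fun n ↦ (1 / 2) ^ n)
  let b : ℕ ⊕ ℕ → ℝ := Sum.elim (fun _ ↦ 1) (fun n ↦ (1 / 2) ^ n)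
  have hhalf : ∀ n : ℕ, ((1 : ℝ) / 2) ^ n ≤ 1 := fun n ↦
    pow_le_one₀ (by norm_num) (by norm_num)
  have ha : ∀ i, 0 < a i := by rintro (n | n) <;> exact pow_pos one_half_pos n
  have ha1 : ∀ i, a i ≤ 1 := by rintro (n | n) <;> exact hhalf n
  have hb : ∀ i, 0 < b i := by
    rintro (n | n)
    exacts [one_pos, pow_pos one_half_pos n]
  have hb1 : ∀ i, b i ≤ 1 := by
    rintro (n | n)
    exacts [le_rfl, hhalf n]
  have hθ : ∀ x ∈ H, (∀ i, θ i x = 1) → x = 0 := fun x hx h ↦ hsep x hx fun i ↦ h (Sum.inr i)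
  let τ := normTopology (weightedNorm ha ha1 hθ)
  let ν := normTopology (weightedNorm hb hb1 hθ)
  have hτ : IsLqcGroupTopology τ := isLqcGroupTopology_weightedNorm ha ha1 hθ
  have hν : IsLqcGroupTopology ν := isLqcGroupTopology_weightedNorm hb hb1 hθ
  have hsmall : ∀ ε > 0, ∃ N : ℕ, ∀ n ≥ N, ((1 : ℝ) / 2) ^ n * 2 < ε := by
    intro ε hε
    obtain ⟨N, hN⟩ := exists_pow_lt_of_lt_one (half_pos hε) one_half_lt_one
    refine ⟨N, fun n hn ↦ ?_⟩
    have := pow_le_pow_of_le_one (one_half_pos (α := ℝ)).le (one_half_lt_one (α := ℝ)).le hn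
    linarith
  have htail : ∀ (N n : ℕ) (z : Circle) (ε : ℝ), (∀ n ≥ N, ((1 : ℝ) / 2) ^ n * 2 < ε) →
      (n < N → circleNorm z < ε) → ((1 : ℝ) / 2) ^ n * circleNorm z ≤ ε := by
    intro N n z ε hN hz
    have h3 := circleNorm_nonneg z
    by_cases hn : n < N
    · nlinarith [hz hn, hhalf n]
    · have h4 := mul_le_mul_of_nonneg_left (circleNorm_le_two z)
        (pow_pos one_half_pos n : (0 : ℝ) < (1 / 2) ^ n).le
      linarith [hN n (not_lt.1 hn)]
  have hab : ∀ x, weightedSup H θ a x ≤ weightedSup H θ b x := by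
    intro x
    by_cases hx : x ∈ H
    · refine weightedSup_le hx (weightedSup_nonneg hb x) fun i ↦
        le_trans ?_ (le_weightedSup hb1 hx i)
      refine mul_le_mul_of_nonneg_right ?_ (circleNorm_nonneg _)
      rcases i with n | n
      exacts [hhalf n, le_rfl]
    · simp [weightedSup, hx]
  have hdual : dual ν = dual τ := by
    refine Set.Subset.antisymm (fun φ hφ ↦ ?_) fun φ hφ ↦ ?_
    · have hφ' : UniformlyContinuousOn H χ ψ φ := by
        intro ε hε
        obtain ⟨δ, hδ, hδφ⟩ := mem_nhds_normTopology.1 (eventually_circleNorm_lt hφ hε)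
        obtain ⟨N, hN⟩ := hsmall (δ / 2) (by positivity)
        refine ⟨δ / 2, by positivity, N, fun x hx hx1 hx2 ↦ hδφ x ?_⟩
        refine (weightedSup_le hx (by positivity : 0 ≤ δ / 2) ?_).trans_lt (by linarith)
        rintro (n | n)
        · exact (one_mul _).trans_le (hx1 n).le
        · exact htail N n _ _ hN (hx2 n)
      refine mem_dual_of_eventually hτ.isTopologicalAddGroup fun ε hε ↦ ?_
      obtain ⟨δ, hδ, N, hN⟩ := pointwise_continuous_of_uniformlyContinuousOn h1 h2 hφ' hε
      refine mem_nhds_normTopology.2 ⟨min 2 ((1 / 2) ^ N * δ), by positivity, fun x hx ↦ ?_⟩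
      obtain ⟨hx2, hxδ⟩ := lt_min_iff.1 hx
      have hxH := mem_of_weightedSup_lt hx2
      have hlt : ∀ n < N, ∀ i, a i = (1 / 2) ^ n → circleNorm (θ i x) < δ := by
        intro n hn i hi
        have h3 := (le_weightedSup ha1 hxH i).trans_lt hxδ
        rw [hi] at h3
        have h4 := pow_le_pow_of_le_one one_half_pos.le (one_half_lt_one (α := ℝ)).le hn.le
        refine lt_of_mul_lt_mul_left (h3.trans_le ?_) (pow_pos one_half_pos n).le
        exact mul_le_mul_of_nonneg_right h4 hδ.le
      exact hN x hxH (fun n hn ↦ hlt n hn (Sum.inl n) rfl) fun n hn ↦ hlt n hn (Sum.inr n) rfl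
    · refine mem_dual_of_eventually hν.isTopologicalAddGroup fun ε hε ↦ ?_
      obtain ⟨δ, hδ, hδφ⟩ := mem_nhds_normTopology.1 (eventually_circleNorm_lt hφ hε)
      exact mem_nhds_normTopology.2 ⟨δ, hδ, fun x hx ↦ hδφ x ((hab x).trans_lt hx)⟩
  have hle : τ ≤ ν := (hG τ hτ.isTopologicalAddGroup (metrizableSpace_normTopology _)
    hτ.isLocallyQuasiConvex).2 ν ⟨hν, hdual⟩
  have hball : {x | weightedSup H θ b x < 1} ∈ @nhds G ν 0 :=
    mem_nhds_normTopology.2 ⟨1, one_pos, fun x hx ↦ hx⟩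
  obtain ⟨ε, hε, hεb⟩ := mem_nhds_normTopology.1 (nhds_mono hle hball)
  obtain ⟨N, hN⟩ := hsmall (ε / 2) (by positivity)
  -- A single spike at index `N`: small for `τ`, since its weight there is tiny, but not for `ν`.
  obtain ⟨x, hx, hx1, hx2, hx3⟩ := h2 (N + 1) (fun n ↦ if n = N then -1 else 1)
    (min 1 (ε / 2)) (by positivity)
  have hxε : weightedSup H θ a x < ε := by
    refine (weightedSup_le hx (by positivity : 0 ≤ ε / 2) ?_).trans_lt (by linarith)
    rintro (n | n)
    · refine htail N n _ _ hN fun hn ↦ ?_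
      have h3 := hx1 n (by omega)
      rw [if_neg hn.ne, div_one] at h3
      exact h3.trans_le (min_le_right _ _)
    · exact htail N n _ _ hN fun hn ↦ (hx3 n (by omega)).trans_le (min_le_right _ _)
  have hx4 : circleNorm (χ N x) < 1 :=
    ((one_mul _).symm.trans_le (le_weightedSup (θ := θ) hb1 hx (Sum.inl N))).trans_lt
      (hεb x hxε)
  have hx5 := hx1 N (by omega)
  rw [if_pos rfl, circleNorm_div_comm] at hx5
  have hx6 := circleNorm_le_add_div (-1) (χ N x)
  have hx7 : circleNorm (-1) = 2 := by
    have : ((-1 : Circle) : ℂ) - 1 = -2 := by push_cast; norm_num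
    rw [circleNorm, this]; norm_num
  linarith [min_le_left 1 (ε / 2)]

/-! ### Closed subgroups of a torus are determined by their annihilators -/

section Torus

open MeasureTheory

variable {ι : Type*} [Fintype ι]

/-- The Laurent monomial `z ↦ ∏ z_i ^ k_i` as a character of the torus. -/
noncomputable def torusChar (k : ι → ℤ) : (ι → Circle) →* Circle where
  toFun z := ∏ i, z i ^ k i
  map_one' := by simp
  map_mul' z w := by simp [mul_zpow, Finset.prod_mul_distrib]

lemma continuous_torusChar (k : ι → ℤ) : Continuous (torusChar k) := by
  change Continuous fun z : ι → Circle ↦ ∏ i, z i ^ k i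
  fun_prop

/-- The Laurent monomials as complex valued functions. -/
noncomputable def torusMonomial (k : ι → ℤ) : C(ι → Circle, ℂ) :=
  ⟨fun z ↦ torusChar k z, continuous_subtype_val.comp (continuous_torusChar k)⟩

lemma torusMonomial_mul (k l : ι → ℤ) :
    torusMonomial k * torusMonomial l = torusMonomial (k + l) := by
  ext z
  simp [torusMonomial, torusChar, zpow_add, Finset.prod_mul_distrib]

variable (ι) in
/-- The star algebra of Laurent polynomials. -/
noncomputable def torusPolynomials : StarSubalgebra ℂ C(ι → Circle, ℂ) where
  toSubalgebra := Algebra.adjoin ℂ (Set.range torusMonomial)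
  star_mem' := by
    change Algebra.adjoin ℂ (Set.range torusMonomial) ≤
      star (Algebra.adjoin ℂ (Set.range torusMonomial))
    refine Algebra.adjoin_le ?_
    rintro _ ⟨k, rfl⟩
    refine Algebra.subset_adjoin ⟨-k, ?_⟩
    ext z
    change ((torusChar (-k) z : Circle) : ℂ) = (starRingEnd ℂ) (torusChar k z)
    rw [← Circle.coe_inv_eq_conj]
    simp [torusChar]

lemma torusPolynomials_eq_span : Subalgebra.toSubmodule (torusPolynomials ι).toSubalgebra =
    Submodule.span ℂ (Set.range (torusMonomial (ι := ι))) := by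
  apply Algebra.adjoin_eq_span_of_subset
  refine .trans (fun x ↦ Submonoid.closure_induction (fun _ ↦ id) ⟨0, ?_⟩ ?_)
    Submodule.subset_span
  · ext z
    simp [torusMonomial, torusChar]
  · rintro _ _ _ _ ⟨m, rfl⟩ ⟨n, rfl⟩
    exact ⟨m + n, (torusMonomial_mul m n).symm⟩

lemma torusPolynomials_separatesPoints : (torusPolynomials ι).SeparatesPoints := by
  classical
  intro x y hxy
  obtain ⟨i, hi⟩ := Function.ne_iff.1 hxy
  refine ⟨_, ⟨torusMonomial (Pi.single i 1), Algebra.subset_adjoin ⟨Pi.single i 1, rfl⟩, rfl⟩, ?_⟩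
  have h : ∀ z : ι → Circle, torusChar (Pi.single i 1) z = z i := by
    intro z
    change ∏ j, z j ^ (Pi.single i (1 : ℤ) : ι → ℤ) j = z i
    rw [Finset.prod_eq_single i]
    · simp
    · intro j _ hj; simp [Pi.single_eq_of_ne hj]
    · simp
  change ((torusChar (Pi.single i 1) x : Circle) : ℂ) ≠ torusChar (Pi.single i 1) y
  rw [h, h]
  exact fun h ↦ hi (Circle.coe_injective h)

/-- A closed subgroup of a torus contains every point at which all characters vanishing on the
subgroup are trivial. -/
theorem mem_of_forall_torusChar {C : Subgroup (ι → Circle)} (hC : IsClosed (C : Set (ι → Circle)))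
    {t : ι → Circle} (ht : ∀ k, (∀ c ∈ C, torusChar k c = 1) → torusChar k t = 1) : t ∈ C := by
  by_contra htC
  have : CompactSpace C := isCompact_iff_compactSpace.1 hC.isCompact
  let _ : MeasurableSpace C := borel C
  have _ : BorelSpace C := ⟨rfl⟩
  let μ : Measure C := Measure.haarMeasure ⊤
  have hμ : IsProbabilityMeasure μ := ⟨by
    have := Measure.haarMeasure_self (K₀ := (⊤ : TopologicalSpace.PositiveCompacts C))
    simpa using this⟩
  have hint : ∀ (s : ι → Circle) (g : C(ι → Circle, ℂ)),
      Integrable (fun c : C ↦ g (s * c)) μ := fun s g ↦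
    (g.continuous.comp (continuous_const.mul continuous_subtype_val)).integrable_of_hasCompactSupport
      (HasCompactSupport.of_compactSpace _)
  -- Averages over `C` and over the coset `t C` agree on Laurent polynomials: a monomial nontrivial
  -- on `C` averages to `0`, and one trivial on `C` is also trivial at `t`. A polynomial within `1 /
  -- 3` of a Urysohn function separating the two cosets contradicts this.
  have hspan : ∀ g ∈ Submodule.span ℂ (Set.range (torusMonomial (ι := ι))),
      ∫ c : C, g (1 * c) ∂μ = ∫ c : C, g (t * c) ∂μ := by
    intro g hg
    induction hg using Submodule.span_induction with
    | mem g hg =>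
      obtain ⟨k, rfl⟩ := hg
      have hm : ∀ s : ι → Circle, ∫ c : C, torusMonomial k (s * c) ∂μ =
          (torusChar k s : ℂ) * ∫ c : C, (torusChar k c : ℂ) ∂μ := by
        intro s
        rw [← integral_const_mul]
        refine integral_congr_ae (ae_of_all _ fun c ↦ ?_)
        change ((torusChar k (s * c) : Circle) : ℂ) = _
        rw [map_mul, Circle.coe_mul]
      rw [hm, hm]
      by_cases hk : ∀ c ∈ C, torusChar k c = 1
      · rw [ht k hk, map_one]
      · push Not at hk
        obtain ⟨c₀, hc₀, hk⟩ := hk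
        have h0 : ∫ c : C, (torusChar k c : ℂ) ∂μ = 0 := by
          have h1 := integral_mul_left_eq_self (μ := μ) (fun c : C ↦ (torusChar k c : ℂ)) ⟨c₀, hc₀⟩
          simp only [Subgroup.coe_mul, map_mul, Circle.coe_mul] at h1
          rw [integral_const_mul] at h1
          by_contra h2
          exact hk (Circle.coe_eq_one.1 (mul_eq_right₀ h2 |>.1 h1))
        rw [h0, mul_zero, mul_zero]
    | zero => simp
    | add f g _ _ hf hg =>
      simp only [ContinuousMap.add_apply]
      rw [integral_add (hint 1 f) (hint 1 g), integral_add (hint t f) (hint t g), hf, hg]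
    | smul a f _ hf =>
      simp only [ContinuousMap.smul_apply]
      rw [integral_smul, integral_smul, hf]
  have hclosed : IsClosed ((fun z ↦ t⁻¹ * z) ⁻¹' (C : Set (ι → Circle))) :=
    hC.preimage (continuous_const.mul continuous_id)
  have hdisj : Disjoint (C : Set (ι → Circle)) ((fun z ↦ t⁻¹ * z) ⁻¹' (C : Set (ι → Circle))) := by
    rw [Set.disjoint_left]
    intro z hz hz'
    exact htC (by simpa using C.mul_mem hz (C.inv_mem hz'))
  obtain ⟨f, hf0, hf1, -⟩ := exists_continuous_zero_one_of_isClosed hC hclosed hdisj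
  let F : C(ι → Circle, ℂ) := ⟨fun z ↦ (f z : ℂ), Complex.continuous_ofReal.comp f.continuous⟩
  have hF : F ∈ (torusPolynomials ι).topologicalClosure := by
    rw [ContinuousMap.starSubalgebra_topologicalClosure_eq_top_of_separatesPoints _
      torusPolynomials_separatesPoints]
    trivial
  obtain ⟨p, hp, hpF⟩ := Metric.mem_closure_iff.1 hF (1 / 3) (by norm_num)
  have hp' : p ∈ Submodule.span ℂ (Set.range (torusMonomial (ι := ι))) := by
    rw [← torusPolynomials_eq_span]
    exact hp
  have hbound : ∀ z, ‖p z - F z‖ ≤ 1 / 3 := by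
    intro z
    rw [← dist_eq_norm, dist_comm]
    exact (ContinuousMap.dist_apply_le_dist z).trans hpF.le
  have h0 : ‖∫ c : C, p (1 * c) ∂μ‖ ≤ 1 / 3 := by
    have := norm_integral_le_of_norm_le_const (μ := μ) (f := fun c : C ↦ p (1 * c)) (C := 1 / 3)
      (ae_of_all _ fun c ↦ ?_)
    · simpa using this
    · have h1 := hbound (1 * c)
      have h2 : F (1 * c) = 0 := by
        change ((f (1 * c) : ℝ) : ℂ) = 0
        rw [one_mul, hf0 c.2]; simp
      rwa [h2, sub_zero] at h1
  have h1 : ‖∫ c : C, (p (t * c) - 1) ∂μ‖ ≤ 1 / 3 := by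
    have := norm_integral_le_of_norm_le_const (μ := μ) (f := fun c : C ↦ p (t * c) - 1) (C := 1 / 3)
      (ae_of_all _ fun c ↦ ?_)
    · simpa using this
    · have h1 := hbound (t * c)
      have h2 : F (t * c) = 1 := by
        change ((f (t * c) : ℝ) : ℂ) = 1
        rw [hf1 (by simp)]; simp
      rwa [h2] at h1
  rw [integral_sub (hint t p) (integrable_const _), ← hspan p hp'] at h1
  simp only [integral_const, probReal_univ, one_smul] at h1
  have h2 := norm_sub_norm_le (1 : ℂ) (∫ c : C, p (1 * c) ∂μ)
  rw [norm_sub_rev, norm_one] at h2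
  linarith

end Torus

/-! ### Kronecker approximation -/

section Kronecker

variable {ι : Type*} [Fintype ι] {H : Type*} [AddCommGroup H]

/-- Kronecker's approximation theorem for finitely many characters. -/
theorem kronecker (χ : ι → AddChar H Circle) (t : ι → Circle)
    (h : ∀ k : ι → ℤ, ∏ i, χ i ^ k i = 1 → ∏ i, t i ^ k i = 1) {ε : ℝ} (hε : 0 < ε) :
    ∃ x, ∀ i, circleNorm (χ i x / t i) < ε := by
  let e : Multiplicative H →* (ι → Circle) := MonoidHom.pi fun i ↦ (χ i).toMonoidHom
  have ht : t ∈ e.range.topologicalClosure := by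
    refine mem_of_forall_torusChar (Subgroup.isClosed_topologicalClosure _) fun k hk ↦ h k ?_
    ext x
    rw [AddChar.prod_apply, AddChar.one_apply]
    have := hk (e (Multiplicative.ofAdd x)) (subset_closure ⟨_, rfl⟩)
    have h1 : ∏ i, χ i x ^ k i = 1 := this
    simpa using congrArg ((↑) : Circle → ℂ) h1
  obtain ⟨_, ⟨x, rfl⟩, hx⟩ := Metric.mem_closure_iff.1 ht ε hε
  refine ⟨x.toAdd, fun i ↦ ?_⟩
  rw [← dist_eq_circleNorm, dist_comm]
  exact (dist_le_pi_dist _ _ i).trans_lt hx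

end Kronecker

/-! ### Baire category in the compact dual -/

section DualTopology

variable {H : Type*} [AddCommGroup H]

/-- The topology of pointwise convergence on the character group. -/
noncomputable instance : TopologicalSpace (AddChar H Circle) :=
  TopologicalSpace.induced (fun χ ↦ (χ : H → Circle)) inferInstance

lemma isClosedEmbedding_addChar_coe :
    Topology.IsClosedEmbedding (fun χ : AddChar H Circle ↦ (χ : H → Circle)) := by
  refine ⟨⟨⟨rfl⟩, DFunLike.coe_injective⟩, ?_⟩
  have : Set.range (fun χ : AddChar H Circle ↦ (χ : H → Circle)) =
      {f | f 0 = 1} ∩ ⋂ x, ⋂ y, {f | f (x + y) = f x * f y} := by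
    ext f
    simp only [Set.mem_range, Set.mem_inter_iff, Set.mem_ofPred_eq, Set.mem_iInter]
    constructor
    · rintro ⟨χ, rfl⟩
      exact ⟨χ.map_zero_eq_one, χ.map_add_eq_mul⟩
    · rintro ⟨h0, h1⟩
      exact ⟨⟨f, h0, h1⟩, rfl⟩
  rw [this]
  refine (isClosed_eq (continuous_apply _) continuous_const).inter
    (isClosed_iInter fun x ↦ isClosed_iInter fun y ↦ isClosed_eq (continuous_apply _) ?_)
  fun_prop

instance : CompactSpace (AddChar H Circle) := isClosedEmbedding_addChar_coe.compactSpace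

instance : T2Space (AddChar H Circle) := isClosedEmbedding_addChar_coe.isEmbedding.t2Space

instance : IsTopologicalGroup (AddChar H Circle) := by
  let f : AddChar H Circle →* (H → Circle) :=
    { toFun := fun χ ↦ χ
      map_one' := rfl
      map_mul' := fun _ _ ↦ rfl }
  exact topologicalGroup_induced f

lemma continuous_addChar_eval (x : H) : Continuous fun χ : AddChar H Circle ↦ χ x :=
  (continuous_apply x).comp isClosedEmbedding_addChar_coe.continuous

lemma isClosed_setOf_zpow_eq (k : ℤ) (a : AddChar H Circle) :
    IsClosed {χ : AddChar H Circle | χ ^ k = a} :=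
  isClosed_eq (continuous_zpow k) continuous_const

/-- Translating an interior point shows that the kernel of `χ ↦ χ ^ k` is open, hence of finite
index by compactness. So the dual has finite exponent, and characters separate points. -/
lemma exists_nsmul_eq_zero_of_interior_nonempty {k : ℤ} (hk : k ≠ 0) {a : AddChar H Circle}
    (h : (interior {χ : AddChar H Circle | χ ^ k = a}).Nonempty) : IsBoundedGroup H := by
  obtain ⟨χ₀, hχ₀⟩ := h
  let S : Subgroup (AddChar H Circle) := (zpowGroupHom k).ker
  have hS : IsOpen (S : Set (AddChar H Circle)) := by
    refine S.isOpen_of_mem_nhds (g := 1) ?_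
    have h1 : Filter.Tendsto (fun χ ↦ χ₀ * χ) (nhds 1) (nhds χ₀) := by
      have := (continuous_const_mul χ₀).tendsto 1
      rwa [mul_one] at this
    filter_upwards [h1 (mem_interior_iff_mem_nhds.1 hχ₀)] with χ hχ
    have h2 : χ₀ ∈ {χ : AddChar H Circle | χ ^ k = a} := interior_subset hχ₀
    replace h2 : χ₀ ^ k = a := h2
    have h3 : (χ₀ * χ) ^ k = a := hχ
    rw [mul_zpow, h2, mul_eq_left] at h3
    exact h3
  have hfin : Finite (AddChar H Circle ⧸ S) := S.quotient_finite_of_isOpen hS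
  have hind : S.index ≠ 0 := Subgroup.index_ne_zero_of_finite
  refine ⟨S.index * k.natAbs, by positivity, fun x ↦ ?_⟩
  by_contra hx
  obtain ⟨χ, hχ⟩ := exists_addChar_apply_ne_one hx
  refine hχ ?_
  have h1 : (χ ^ S.index) ^ k = 1 := S.pow_index_mem χ
  have h2 : (χ ^ S.index) ^ k.natAbs = 1 := by
    rcases Int.natAbs_eq k with h | h
    · rw [h, zpow_natCast] at h1; exact h1
    · rw [h, zpow_neg, zpow_natCast, inv_eq_one] at h1; exact h1
  rw [AddChar.map_nsmul_eq_pow, ← AddChar.pow_apply, pow_mul, h2, AddChar.one_apply]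

/-- In the dual of an unbounded group, there are arbitrarily small characters none of whose
nontrivial powers lies in a given countable set. -/
theorem exists_addChar_zpow_notMem (hH : ¬ IsBoundedGroup H) {A : Set (AddChar H Circle)}
    (hA : A.Countable) {F : Set H} (hF : F.Finite) {ε : ℝ} (hε : 0 < ε) :
    ∃ χ : AddChar H Circle, (∀ x ∈ F, circleNorm (χ x) < ε) ∧ ∀ k : ℤ, k ≠ 0 → χ ^ k ∉ A := by
  have := hA.to_subtype
  have hd : Dense (⋂ j : {k : ℤ // k ≠ 0} × A,
      {χ : AddChar H Circle | χ ^ (j.1 : ℤ) = j.2}ᶜ) := by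
    refine dense_iInter_of_isOpen (fun j ↦ (isClosed_setOf_zpow_eq _ _).isOpen_compl) fun j ↦ ?_
    rw [← interior_eq_empty_iff_dense_compl]
    by_contra h
    exact hH (exists_nsmul_eq_zero_of_interior_nonempty j.1.2 (Set.nonempty_iff_ne_empty.2 h))
  have hU : IsOpen (⋂ x ∈ F, {χ : AddChar H Circle | circleNorm (χ x) < ε}) :=
    hF.isOpen_biInter fun x _ ↦ isOpen_lt
      (continuous_circleNorm.comp (continuous_addChar_eval x)) continuous_const
  obtain ⟨χ, hχ1, hχ2⟩ := hd.inter_open_nonempty _ hU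
    ⟨1, by simp [circleNorm_one, hε]⟩
  simp only [Set.mem_iInter] at hχ1 hχ2
  exact ⟨χ, hχ1, fun k hk hkA ↦ hχ2 (⟨k, hk⟩, ⟨_, hkA⟩) rfl⟩

/-- For every sequence of nonzero elements, some character is nontrivial on infinitely many
of them. -/
theorem exists_addChar_frequently_ne_one {x : ℕ → H} (hx : ∀ n, x n ≠ 0) :
    ∃ χ : AddChar H Circle, ∀ n, ∃ m ≥ n, χ (x m) ≠ 1 := by
  by_contra! h
  let C : ℕ → Subgroup (AddChar H Circle) := fun n ↦
    { carrier := {χ | ∀ m ≥ n, χ (x m) = 1}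
      mul_mem' := fun ha hb m hm ↦ by simp [ha m hm, hb m hm]
      one_mem' := fun m _ ↦ rfl
      inv_mem' := fun {a} ha m hm ↦ by simp [AddChar.map_neg_eq_inv, ha m hm] }
  have hmono : Monotone C := fun n m hnm χ hχ l hl ↦ hχ l (hnm.trans hl)
  have hclosed : ∀ n, IsClosed (C n : Set (AddChar H Circle)) := by
    intro n
    have : (C n : Set (AddChar H Circle)) = ⋂ m ≥ n, {χ | χ (x m) = 1} := by
      ext χ
      simp only [Set.mem_iInter]
      exact Iff.rfl
    rw [this]
    exact isClosed_biInter fun m _ ↦ isClosed_eq (continuous_addChar_eval _) continuous_const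
  have hunion : ⋃ n, (C n : Set (AddChar H Circle)) = Set.univ :=
    Set.eq_univ_of_forall fun χ ↦ Set.mem_iUnion.2 (h χ)
  -- By Baire some `C n` is open, so are all later ones, and compactness makes one of them the whole
  -- dual; this is impossible because characters separate points.
  obtain ⟨n, χ₀, hn⟩ := nonempty_interior_of_iUnion_of_closed hclosed hunion
  have hopen : ∀ m ≥ n, IsOpen (C m : Set (AddChar H Circle)) := fun m hm ↦
    (C m).isOpen_of_mem_nhds (Filter.mem_of_superset (mem_interior_iff_mem_nhds.1 hn) (hmono hm))
  obtain ⟨m, hm⟩ := isCompact_univ.elim_directed_cover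
    (fun m ↦ (C (n + m) : Set (AddChar H Circle))) (fun m ↦ hopen _ (Nat.le_add_right n m))
    (fun χ _ ↦ by
      obtain ⟨m, hm⟩ := h χ
      exact Set.mem_iUnion.2 ⟨m, hmono (Nat.le_add_left m n) hm⟩)
    (Monotone.directed_le fun a b hab ↦ hmono (Nat.add_le_add_left hab n))
  obtain ⟨χ, hχ⟩ := exists_addChar_apply_ne_one (hx (n + m))
  exact hχ (hm (Set.mem_univ χ) (n + m) le_rfl)

end DualTopology

/-! ### Inductive construction of the characters -/

/-- Recursive construction of a sequence, each term of which depends on the previous ones. -/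
lemma exists_seq_of_forall_prefix {α : Type*} [Inhabited α] {P : ℕ → (ℕ → α) → α → Prop}
    (h : ∀ N g, ∃ c, P N g c)
    (hP : ∀ N g g' c, (∀ i < N, g i = g' i) → P N g c → P N g' c) :
    ∃ f : ℕ → α, ∀ N, P N f (f N) := by
  choose step hstep using h
  let F : ℕ → ℕ → α := fun N ↦
    Nat.rec (fun _ ↦ default) (fun N g ↦ Function.update g N (step N g)) N
  have hF : ∀ N, F (N + 1) = Function.update (F N) N (step N (F N)) := fun N ↦ rfl
  have hf : ∀ N, ∀ i < N, F N i = F (i + 1) i := by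
    intro N
    induction N with
    | zero => intro i hi; omega
    | succ N ih =>
      intro i hi
      rcases (Nat.lt_succ_iff_lt_or_eq.1 hi) with hi | rfl
      · rw [hF, Function.update_of_ne hi.ne, ih i hi]
      · rfl
  refine ⟨fun N ↦ F (N + 1) N, fun N ↦ hP N (F N) _ _ (hf N) ?_⟩
  change P N (F N) (F (N + 1) N)
  rw [hF, Function.update_self]
  exact hstep N (F N)

lemma countable_subgroup_closure {K : Type*} [Group K] {S : Set K} (hS : S.Countable) :
    (Subgroup.closure S : Set K).Countable := by
  have := hS.to_subtype
  have : Countable (FreeGroup S) := Function.Surjective.countable (Quot.mk_surjective)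
  rw [FreeGroup.closure_eq_range, MonoidHom.coe_range]
  exact Set.countable_range _

section Construction

variable {H : Type*} [AddCommGroup H]

/-- `g 0, …, g (N - 1)` are independent modulo the subgroup generated by the `ψ i`. -/
def IndependentModulo (ψ g : ℕ → AddChar H Circle) (N : ℕ) : Prop :=
  ∀ n < N, ∀ k : ℤ, k ≠ 0 → g n ^ k ∉ Subgroup.closure (Set.range ψ ∪ g '' Set.Iio n)

lemma IndependentModulo.eq_zero {ψ g : ℕ → AddChar H Circle} {N : ℕ}
    (h : IndependentModulo ψ g N) {k : ℕ → ℤ}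
    (hk : ∏ n ∈ Finset.range N, g n ^ k n ∈ Subgroup.closure (Set.range ψ)) :
    ∀ n < N, k n = 0 := by
  induction N with
  | zero => intro n hn; omega
  | succ N ih =>
    have hN : k N = 0 := by
      by_contra hkN
      refine h N N.lt_succ_self (k N) hkN ?_
      rw [Finset.prod_range_succ] at hk
      refine (mul_mem_cancel_left (Subgroup.prod_mem _ fun n hn ↦ ?_)).1
        (Subgroup.closure_mono Set.subset_union_left hk)
      have hn' : g n ∈ Subgroup.closure (Set.range ψ ∪ g '' Set.Iio N) :=
        Subgroup.subset_closure (Or.inr ⟨n, Finset.mem_range.1 hn, rfl⟩)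
      exact zpow_mem hn' _
    rw [Finset.prod_range_succ, hN, zpow_zero, mul_one] at hk
    intro n hn
    rcases (Nat.lt_succ_iff_lt_or_eq.1 hn) with hn | rfl
    · exact ih (fun n hn ↦ h n (hn.trans N.lt_succ_self)) hk n hn
    · exact hN

/-- Independence modulo the `ψ i` means that every multiplicative relation involves the `g n`
trivially, so Kronecker's theorem allows arbitrary targets for `g` together with target `1` for `ψ`.
-/
lemma IndependentModulo.exists_approx {ψ g : ℕ → AddChar H Circle} {N : ℕ}
    (h : IndependentModulo ψ g N) (t : ℕ → Circle) {ε : ℝ} (hε : 0 < ε) :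
    ∃ x, (∀ n < N, circleNorm (g n x / t n) < ε) ∧ ∀ i < N, circleNorm (ψ i x) < ε := by
  have hker : ∀ k : Fin N ⊕ Fin N → ℤ,
      ∏ i, Sum.elim (fun n : Fin N ↦ g n) (fun n : Fin N ↦ ψ n) i ^ k i = 1 →
      ∏ i, Sum.elim (fun n : Fin N ↦ t n) (fun _ : Fin N ↦ (1 : Circle)) i ^ k i = 1 := by
    intro k hk
    rw [Fintype.prod_sum_type] at hk ⊢
    simp only [Sum.elim_inl, Sum.elim_inr, one_zpow, Finset.prod_const_one, mul_one] at hk ⊢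
    let k' : ℕ → ℤ := fun n ↦ if h : n < N then k (Sum.inl ⟨n, h⟩) else 0
    have hk' : ∀ n : Fin N, k (Sum.inl n) = k' n := fun n ↦ by simp [k']
    have h0 : ∀ n < N, k' n = 0 := by
      refine h.eq_zero ?_
      rw [← Fin.prod_univ_eq_prod_range (fun n ↦ g n ^ k' n)]
      simp only [← hk']
      rw [eq_inv_of_mul_eq_one_left hk]
      exact Subgroup.inv_mem _ (Subgroup.prod_mem _ fun i _ ↦
        zpow_mem (Subgroup.subset_closure (Set.mem_range_self _)) _)
    refine Finset.prod_eq_one fun n _ ↦ ?_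
    rw [hk', h0 n n.2, zpow_zero]
  obtain ⟨x, hx⟩ := kronecker _ _ hker hε
  refine ⟨x, fun n hn ↦ hx (Sum.inl ⟨n, hn⟩), fun i hi ↦ ?_⟩
  simpa using hx (Sum.inr ⟨i, hi⟩)

/-- `E` contains approximate solutions, up to `2⁻ᴺ`, for all prescribed values of
`g 0, …, g (N - 1)`. -/
def IsApproximationNet (ψ g : ℕ → AddChar H Circle) (N : ℕ) (E : Finset H) : Prop :=
  ∀ t : ℕ → Circle, ∃ x ∈ E, (∀ n < N, circleNorm (g n x / t n) < (1 / 2) ^ N) ∧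
    ∀ i < N, circleNorm (ψ i x) < (1 / 2) ^ N

/-- Compactness of the space of targets makes finitely many `x` suffice, so later characters can be
chosen small on all of them. -/
lemma IndependentModulo.exists_isApproximationNet {ψ g : ℕ → AddChar H Circle} {N : ℕ}
    (h : IndependentModulo ψ g N) : ∃ E, IsApproximationNet ψ g N E := by
  obtain ⟨E, hES, hE⟩ := (isCompact_univ (X := ℕ → Circle)).elim_finite_subcover_image
    (b := {x : H | ∀ i < N, circleNorm (ψ i x) < (1 / 2) ^ N})
    (c := fun x ↦ ⋂ n ∈ Finset.range N, {t : ℕ → Circle | circleNorm (g n x / t n) < (1 / 2) ^ N})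
    (fun x _ ↦ isOpen_biInter_finset fun n _ ↦ isOpen_lt
      (continuous_circleNorm.comp (continuous_const.div' (continuous_apply n))) continuous_const)
    (fun t _ ↦ by
      obtain ⟨x, hx1, hx2⟩ := h.exists_approx t (ε := (1 / 2) ^ N) (by positivity)
      refine Set.mem_biUnion (x := x) hx2 ?_
      simp only [Set.mem_iInter, Finset.mem_range]
      exact hx1)
  refine ⟨hE.1.toFinset, fun t ↦ ?_⟩
  obtain ⟨x, hx, hxt⟩ := Set.mem_iUnion₂.1 (hE.2 (Set.mem_univ t))
  simp only [Set.mem_iInter, Finset.mem_range] at hxt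
  exact ⟨x, by simpa using hx, hxt, hES hx⟩

lemma IsApproximationNet.congr {ψ g g' : ℕ → AddChar H Circle} {N : ℕ} {E : Finset H}
    (h : IsApproximationNet ψ g N E) (hg : ∀ i < N, g i = g' i) :
    IsApproximationNet ψ g' N E := by
  intro t
  obtain ⟨x, hx, hx1, hx2⟩ := h t
  exact ⟨x, hx, fun n hn ↦ hg n hn ▸ hx1 n hn, hx2⟩

open Classical in
/-- A chosen approximation net; it only depends on the first `N` terms of `g`. -/
noncomputable def approximationNet (ψ g : ℕ → AddChar H Circle) (N : ℕ) : Finset H :=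
  -- Truncating before choosing makes equal prefixes yield literally the same net.
  if h : ∃ E, IsApproximationNet ψ (fun i ↦ if i < N then g i else 1) N E then h.choose else ∅

lemma approximationNet_congr {ψ g g' : ℕ → AddChar H Circle} {N : ℕ}
    (hg : ∀ i < N, g i = g' i) : approximationNet ψ g N = approximationNet ψ g' N := by
  have : (fun i ↦ if i < N then g i else 1) = fun i ↦ if i < N then g' i else 1 := by
    funext i
    split_ifs with hi
    exacts [hg i hi, rfl]
  rw [approximationNet, approximationNet, this]

lemma IndependentModulo.isApproximationNet {ψ g : ℕ → AddChar H Circle} {N : ℕ}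
    (h : IndependentModulo ψ g N) : IsApproximationNet ψ g N (approximationNet ψ g N) := by
  have hg : ∀ i < N, g i = if i < N then g i else 1 := fun i hi ↦ (if_pos hi).symm
  obtain ⟨E, hE⟩ := h.exists_isApproximationNet
  have hex : ∃ E, IsApproximationNet ψ (fun i ↦ if i < N then g i else 1) N E :=
    ⟨E, hE.congr hg⟩
  rw [approximationNet, dif_pos hex]
  exact hex.choose_spec.congr fun i hi ↦ (hg i hi).symm

/-- On a countable unbounded group, there are characters converging pointwise to `1` which
approximate all finitely supported sequences. -/
theorem exists_approximating_characters [Countable H] (hH : ¬ IsBoundedGroup H) :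
    ∃ χ ψ : ℕ → AddChar H Circle, TendsToOneOn ⊤ χ ∧ ApproximatesFiniteSequences ⊤ χ ψ ∧
      ∀ x, (∀ i, ψ i x = 1) → x = 0 := by
  obtain ⟨h, hh⟩ := exists_surjective_nat H
  have hψ : ∀ i, ∃ ψ : AddChar H Circle, ψ (h i) = 1 → h i = 0 := by
    intro i
    by_cases hi : h i = 0
    · exact ⟨1, fun _ ↦ hi⟩
    · obtain ⟨ψ, hψ⟩ := exists_addChar_apply_ne_one hi
      exact ⟨ψ, fun h ↦ absurd h hψ⟩
  choose ψ hψ using hψ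
  -- The three requirements give independence, pointwise convergence to `1` on the enumerated group,
  -- and small tails on every earlier net.
  obtain ⟨χ, hχ⟩ := exists_seq_of_forall_prefix
    (P := fun N g (c : AddChar H Circle) ↦
      (∀ k : ℤ, k ≠ 0 → c ^ k ∉ Subgroup.closure (Set.range ψ ∪ g '' Set.Iio N)) ∧
      (∀ i ≤ N, circleNorm (c (h i)) < (1 / 2) ^ N) ∧
      ∀ M ≤ N, ∀ x ∈ approximationNet ψ g M, circleNorm (c x) < (1 / 2) ^ N)
    (fun N g ↦ by
      have hA : (Subgroup.closure (Set.range ψ ∪ g '' Set.Iio N) :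
          Set (AddChar H Circle)).Countable :=
        countable_subgroup_closure
          ((Set.countable_range ψ).union ((Set.finite_Iio N).image g).countable)
      obtain ⟨c, hc1, hc2⟩ := exists_addChar_zpow_notMem hH hA
        (F := h '' Set.Iic N ∪ ⋃ M ∈ Set.Iic N, (approximationNet ψ g M : Set H))
        (((Set.finite_Iic N).image h).union
          ((Set.finite_Iic N).biUnion fun M _ ↦ Finset.finite_toSet _))
        (ε := (1 / 2) ^ N) (by positivity)
      refine ⟨c, hc2, fun i hi ↦ hc1 _ (Or.inl ⟨i, hi, rfl⟩), fun M hM x hx ↦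
        hc1 _ (Or.inr (Set.mem_biUnion (x := M) hM hx))⟩)
    (by
      rintro N g g' c hg ⟨h1, h2, h3⟩
      have h4 : g '' Set.Iio N = g' '' Set.Iio N := Set.image_congr hg
      refine ⟨h4 ▸ h1, h2, fun M hM ↦ ?_⟩
      rw [← approximationNet_congr fun i hi ↦ hg i (lt_of_lt_of_le hi hM)]
      exact h3 M hM)
  have hpow : ∀ ε > 0, ∃ N : ℕ, ((1 : ℝ) / 2) ^ N < ε := fun ε hε ↦
    exists_pow_lt_of_lt_one hε one_half_lt_one
  have hanti : ∀ M N : ℕ, M ≤ N → ((1 : ℝ) / 2) ^ N ≤ (1 / 2) ^ M := fun M N hMN ↦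
    pow_le_pow_of_le_one one_half_pos.le (one_half_lt_one (α := ℝ)).le hMN
  refine ⟨χ, ψ, fun x _ ε hε ↦ ?_, fun N t ε hε ↦ ?_, fun x hx ↦ ?_⟩
  · obtain ⟨i, rfl⟩ := hh x
    obtain ⟨N, hN⟩ := hpow ε hε
    refine ⟨max i N, fun n hn ↦ ?_⟩
    have h1 := (hχ n).2.1 i ((le_max_left _ _).trans hn)
    exact h1.trans_le ((hanti N n ((le_max_right _ _).trans hn)).trans hN.le)
  · obtain ⟨L, hL⟩ := hpow ε hε
    have hind : IndependentModulo ψ χ (max N L) := fun n _ ↦ (hχ n).1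
    obtain ⟨x, hx, hx1, hx2⟩ := hind.isApproximationNet fun n ↦ if n < N then t n else 1
    have hLε : ((1 : ℝ) / 2) ^ max N L < ε := (hanti _ _ (le_max_right _ _)).trans_lt hL
    refine ⟨x, AddSubgroup.mem_top x, fun n hn ↦ ?_, fun n hn ↦ ?_, fun i hi ↦ ?_⟩
    · have h1 := hx1 n (lt_max_of_lt_left hn)
      rw [if_pos hn] at h1
      exact h1.trans hLε
    · by_cases hn' : n < max N L
      · have h1 := hx1 n hn'
        rw [if_neg (not_lt.2 hn), div_one] at h1
        exact h1.trans hLε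
      · have h1 := (hχ n).2.2 _ (not_lt.1 hn') x hx
        exact (h1.trans_le (hanti _ _ (not_lt.1 hn'))).trans hLε
    · exact (hx2 i (lt_max_of_lt_left hi)).trans hLε
  · obtain ⟨i, rfl⟩ := hh x
    exact hψ i (hx i)

end Construction

/-! ### Unbounded groups fail the paradigm -/

lemma exists_countable_unbounded_subgroup (hG : ¬ IsBoundedGroup G) :
    ∃ H : AddSubgroup G, Countable H ∧ ¬ IsBoundedGroup H := by
  have hx : ∀ m : ℕ, ∃ x : G, 0 < m → m • x ≠ 0 := by
    intro m
    by_contra! h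
    exact hG ⟨m, (h 0).1, fun x ↦ (h x).2⟩
  choose x hx using hx
  refine ⟨(Submodule.span ℤ (Set.range x)).toAddSubgroup,
    (inferInstance : Countable (Submodule.span ℤ (Set.range x))), ?_⟩
  rintro ⟨m, hm, h⟩
  exact hx m hm (congrArg Subtype.val (h ⟨x m, Submodule.subset_span ⟨m, rfl⟩⟩))

/-- A group satisfying the Varopoulos paradigm is bounded. -/
theorem isBoundedGroup_of_satisfiesVaropoulosParadigm (hG : SatisfiesVaropoulosParadigm G) :
    IsBoundedGroup G := by
  by_contra hb
  obtain ⟨H, hc, hH⟩ := exists_countable_unbounded_subgroup hb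
  obtain ⟨χ, ψ, h1, h2, h3⟩ := exists_approximating_characters hH
  choose χ' hχ' using fun n ↦ exists_addChar_extension H (χ n)
  choose ψ' hψ' using fun n ↦ exists_addChar_extension H (ψ n)
  refine not_satisfiesVaropoulosParadigm (H := H) (χ := χ') (ψ := ψ')
    (fun x hx ε hε ↦ ?_) (fun N t ε hε ↦ ?_) (fun x hx h ↦ ?_) hG
  · obtain ⟨N, hN⟩ := h1 ⟨x, hx⟩ (AddSubgroup.mem_top _) ε hε
    exact ⟨N, fun n hn ↦ (hχ' n ⟨x, hx⟩) ▸ hN n hn⟩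
  · obtain ⟨x, -, hx⟩ := h2 N t ε hε
    refine ⟨x, x.2, ?_⟩
    simpa only [hχ', hψ'] using hx
  · exact congrArg Subtype.val (h3 ⟨x, hx⟩ fun i ↦ (hψ' i ⟨x, hx⟩).symm.trans (h i))

/-! ### Bounded groups satisfy the paradigm -/

lemma eq_one_of_pow_eq_one_of_circleNorm_le {z : Circle} {m : ℕ} (hm : 0 < m) (hz : z ^ m = 1)
    (h : circleNorm z ≤ 1 / m) : z = 1 := by
  refine eq_one_of_forall_pow_mem_circlePos fun n ↦ mem_circlePos_of_circleNorm_le_one ?_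
  have hm' : (0 : ℝ) < m := by exact_mod_cast hm
  rw [le_div_iff₀ hm', mul_comm] at h
  rw [← Nat.mod_add_div n m, pow_add, pow_mul, hz, one_pow, mul_one]
  refine (circleNorm_pow_le _ _).trans ((mul_le_mul_of_nonneg_right ?_
    (circleNorm_nonneg z)).trans h)
  exact_mod_cast (Nat.mod_lt n hm).le

/-- In a bounded group, every quasi-convex neighbourhood of `0` contains an open subgroup. -/
lemma exists_addSubgroup_subset_of_isQuasiConvex (hG : IsBoundedGroup G)
    {ν : TopologicalSpace G} (hν : @IsTopologicalAddGroup G ν _) {M : Set G}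
    (hM : M ∈ @nhds G ν 0) (hq : IsQuasiConvex ν M) :
    ∃ H : AddSubgroup G, (H : Set G) ∈ @nhds G ν 0 ∧ (H : Set G) ⊆ M := by
  obtain ⟨m, hm, hmG⟩ := hG
  -- The common kernel of the characters mapping `M` into `𝕋₊`; quasi-convexity puts it inside `M`.
  let H : AddSubgroup G :=
    { carrier := {x | ∀ χ ∈ dual ν, (∀ y ∈ M, χ y ∈ circlePos) → χ x = 1}
      zero_mem' := fun χ _ _ ↦ χ.map_zero_eq_one
      add_mem' := fun ha hb χ h1 h2 ↦ by rw [χ.map_add_eq_mul, ha χ h1 h2, hb χ h1 h2, one_mul]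
      neg_mem' := fun {a} ha χ h1 h2 ↦ by rw [χ.map_neg_eq_inv, ha χ h1 h2, inv_one] }
  refine ⟨H, ?_, fun x hx ↦ ?_⟩
  · have hW : ∀ k ∈ Finset.range m, {x : G | k • x ∈ M} ∈ @nhds G ν 0 := by
      intro k _
      have hk : Filter.Tendsto (fun x : G ↦ k • x) (@nhds G ν 0) (@nhds G ν 0) := by
        have := (continuous_nsmul (M := G) k).tendsto 0
        rwa [nsmul_zero] at this
      exact hk hM
    refine Filter.mem_of_superset ((Filter.biInter_finset_mem _).2 hW) fun x hx χ h1 h2 ↦ ?_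
    simp only [Set.mem_iInter, Finset.mem_range] at hx
    refine eq_one_of_forall_pow_mem_circlePos fun n ↦ ?_
    have h3 := h2 _ (hx (n % m) (Nat.mod_lt n hm))
    rw [χ.map_nsmul_eq_pow] at h3
    rwa [← Nat.mod_add_div n m, pow_add, pow_mul, ← χ.map_nsmul_eq_pow m x, hmG,
      χ.map_zero_eq_one, one_pow, mul_one]
  · by_contra hxM
    obtain ⟨χ, h1, h2, h3⟩ := hq x hxM
    refine h3 (mem_circlePos_of_circleNorm_le_one ?_)
    rw [hx χ h1 h2, circleNorm_one]
    exact zero_le_one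

/-- In a bounded group with a first countable group topology, a subgroup all of whose annihilating
characters are continuous is open. -/
lemma mem_nhds_of_annihilator_subset_dual (hG : IsBoundedGroup G) {τ : TopologicalSpace G}
    (hc : (@nhds G τ 0).IsCountablyGenerated) {H : AddSubgroup G}
    (hH : ∀ χ : AddChar G Circle, (∀ x ∈ H, χ x = 1) → χ ∈ dual τ) :
    (H : Set G) ∈ @nhds G τ 0 := by
  obtain ⟨m, hm, hmG⟩ := hG
  by_contra hn
  have hf : ∃ᶠ x in @nhds G τ 0, x ∉ H := fun h ↦
    hn (Filter.mem_of_superset h fun x hx ↦ not_not.1 hx)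
  obtain ⟨x, hx, hxH⟩ := Filter.exists_seq_forall_of_frequently hf
  obtain ⟨χ, hχ⟩ := exists_addChar_frequently_ne_one
    (fun n h ↦ hxH n ((QuotientAddGroup.eq_zero_iff (x n)).1 h) : ∀ n, (x n : G ⧸ H) ≠ 0)
  let θ : AddChar G Circle := χ.compAddMonoidHom (QuotientAddGroup.mk' H)
  have hθ : θ ∈ dual τ := hH θ fun y hy ↦ by
    change χ (y : G ⧸ H) = 1
    rw [(QuotientAddGroup.eq_zero_iff y).2 hy, χ.map_zero_eq_one]
  have hev := hx.eventually (eventually_circleNorm_lt hθ (by positivity : (0 : ℝ) < 1 / m))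
  obtain ⟨N, hN⟩ := Filter.eventually_atTop.1 hev
  obtain ⟨n, hn, hne⟩ := hχ N
  refine hne (eq_one_of_pow_eq_one_of_circleNorm_le hm ?_ (hN n hn).le)
  rw [← χ.map_nsmul_eq_pow, ← QuotientAddGroup.mk_nsmul, hmG, QuotientAddGroup.mk_zero,
    χ.map_zero_eq_one]

/-- Bounded groups satisfy the Varopoulos paradigm. -/
theorem IsBoundedGroup.satisfiesVaropoulosParadigm (hG : IsBoundedGroup G) :
    SatisfiesVaropoulosParadigm G := by
  intro τ hτ hmet hlqc
  refine ⟨⟨⟨hτ, inferInstance, hlqc⟩, rfl⟩, ?_⟩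
  rintro ν ⟨hν, hdual⟩
  have hνg := hν.isTopologicalAddGroup
  rw [← continuous_id_iff_le]
  refine @continuous_of_continuousAt_zero G τ _ hτ G (G →+ G) _ ν hνg.toContinuousAdd _ _
    (AddMonoidHom.id G) ?_
  intro U hU
  obtain ⟨M, hM, hq, hMU⟩ := hν.isLocallyQuasiConvex U hU
  obtain ⟨H, hH, hHM⟩ := exists_addSubgroup_subset_of_isQuasiConvex hG hνg hM hq
  refine Filter.mem_of_superset (mem_nhds_of_annihilator_subset_dual hG ?_ fun χ hχ ↦ ?_)
    (hHM.trans hMU)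
  -- Metrizability enters here, through first countability at `0`.
  · exact inferInstance
  · rw [← hdual]
    refine mem_dual_of_eventually hνg fun ε hε ↦ Filter.mem_of_superset hH fun x hx ↦ ?_
    change circleNorm (χ x) < ε
    rwa [hχ x hx, circleNorm_one]

end VaropoulosParadigm

theorem theoremA (G : Type*) [AddCommGroup G] :
    VaropoulosParadigm.SatisfiesVaropoulosParadigm G ↔ VaropoulosParadigm.IsBoundedGroup G :=
  ⟨VaropoulosParadigm.isBoundedGroup_of_satisfiesVaropoulosParadigm,
    VaropoulosParadigm.IsBoundedGroup.satisfiesVaropoulosParadigm⟩
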